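/- Let $n\ge 1$ and let $L$ be an $n\times n$ matrix with non-negative integer entries and zero diagonal. An arithmetical structure on $L$ is a pair $(\mathbf d,\mathbf r)$ of vectors of positive integers with $(\mathrm{Diag}(\mathbf d)-L)\mathbf r^t=\mathbf 0^t$ and $\gcd(r_1,\dots,r_n)=1$; $\mathcal A(L)$ is the set of these pairs and $\mathcal D(L)=\{\mathbf d : (\mathbf d,\mathbf r)\in\mathcal A(L)\text{ for some }\mathbf r\}$ is the set of $d$-arithmetical structures. Call $L$ reducible if for some permutation matrix $P$ one has $P^tLP=\begin{pmatrix}X&Y\\0&Z\end{pmatrix}$ with $X,Z$ square and non-empty, and irreducible otherwise. An almost non-singular $M$-matrix is a square matrix with non-positive off-diagonal entries, non-negative determinant and positive proper principal minors. Let $\mathcal D_{\ge 0}(L)$ be the set of vectors $\mathbf d$ of positive integers such that $\mathrm{Diag}(\mathbf d)-L$ is an almost non-singular $M$-matrix, and let $\min\mathcal D_{\ge 0}(L)$ be the set of its minimal elements for the componentwise order. The following algorithm $\mathrm{Min}$ takes $L$ as input. For $n=1$ it returns $\{(1)\}$. For $n=2$, with $L=\begin{pmatrix}0&a\\b&0\end{pmatrix}$,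 it returns the minimal elements of $\{(d,\max(1,\lceil ab/d\rceil)) : 1\le d\le\max(1,ab)\}$. For $n\ge 3$: (1) for every $s$ it runs $\mathrm{Min}$ on the matrix $L_s$ obtained from $L$ by deleting the $s$-th row and column, and inserts in each vector obtained a new $s$-th entry equal to $1$, which gives a finite set $A_s$; (2) for every choice of one vector from each $A_s$ it forms the componentwise maximum $\mathbf d$ of the $n$ vectors chosen; (3) for each such $\mathbf d$, let $S(\mathbf d)$ be the set of $s$ such that the coefficient of $x_s$ in $\det(\mathrm{Diag}(X+\mathbf d)-L)$ is $0$, and let $\mathbf e_t$ be the $t$-th unit vector; if $S(\mathbf d)=\emptyset$ it keeps $\mathbf d$; if $|S(\mathbf d)|=1$ it replaces $\mathbf d$ by the vectors $\mathbf d+\mathbf e_t$ with $t\notin S(\mathbf d)$; if $|S(\mathbf d)|\ge 2$ it replaces $\mathbf d$ by the vectors $\mathbf d+\mathbf e_t$ with $t\notin S(\mathbf d)$ and the vectors $\mathbf d+\mathbf e_s+\mathbf e_t$ with $s\in S(\mathbf d)$ and $t\notin S(\mathbf d+\mathbf e_s)$; (4) for each vector $\mathbf d$ so obtained it finds, by search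 in the box $\{0,\dots,\max(0,-\det(\mathrm{Diag}(\mathbf d)-L))\}^n$, the minimal $\mathbf x$ with $\det(\mathrm{Diag}(\mathbf d+\mathbf x)-L)\ge 0$, and collects the vectors $\mathbf d+\mathbf x$; (5) it returns the minimal ones among all the vectors collected. Algorithm AA: if $L$ is irreducible, return the set of those $\mathbf d$ in the output of $\mathrm{Min}$ on $L$ for which $\det(\mathrm{Diag}(\mathbf d)-L)=0$; otherwise, if $L$ has a zero row, return $\emptyset$; otherwise report that there are infinitely many arithmetical structures. Then these algorithms are correct: $\mathrm{Min}$ returns $\min\mathcal D_{\ge 0}(L)$, and (i) if $L$ is irreducible, Algorithm AA returns $\mathcal D(L)$, one has $\mathcal D(L)=\{\mathbf d\in\min\mathcal D_{\ge0}(L) : \det(\mathrm{Diag}(\mathbf d)-L)=0\}$, and every $\mathbf d\in\mathcal D(L)$ belongs to exactly one arithmetical structure $(\mathbf d,\mathbf r)$; (ii) if $L$ has a zero row, Algorithm AA returns $\emptyset$, and $\mathcal D(L)=\mathcal A(L)=\emptyset$; (iii) if $L$ is reducible and has no zero row, Algorithm AA reports infinitely many structures, and the set $\mathcal A(L)$ is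 infinite. -/

import Mathlib

namespace ArithStruct

/-! ### Arithmetical structures -/

/-- The integer matrix `Diag(d) - L`. -/
def diagSub {n : ℕ} (L : Matrix (Fin n) (Fin n) ℕ) (d : Fin n → ℕ) : Matrix (Fin n) (Fin n) ℤ :=
  Matrix.diagonal (fun i => (d i : ℤ)) - L.map (fun a => (a : ℤ))

/-- The arithmetical structures `(d, r)` on `L`. -/
def structures {n : ℕ} (L : Matrix (Fin n) (Fin n) ℕ) : Set ((Fin n → ℕ) × (Fin n → ℕ)) :=
  {p | (∀ i, 0 < p.1 i) ∧ (∀ i, 0 < p.2 i) ∧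
    (diagSub L p.1).mulVec (fun i => (p.2 i : ℤ)) = 0 ∧ Finset.univ.gcd p.2 = 1}

/-- The `d`-arithmetical structures on `L`. -/
def dStructures {n : ℕ} (L : Matrix (Fin n) (Fin n) ℕ) : Set (Fin n → ℕ) :=
  {d | ∃ r, (d, r) ∈ structures L}

/-! ### Irreducibility and M-matrices -/

/-- `L` is reducible: simultaneously permuting rows and columns by some `σ` yields a matrix whose
lower left block (rows `≥ k`, columns `< k`) vanishes, both diagonal blocks being non-empty. -/
def IsReducible {n : ℕ} (L : Matrix (Fin n) (Fin n) ℕ) : Prop :=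
  ∃ k : Fin n, 0 < k.val ∧ ∃ σ : Equiv.Perm (Fin n),
    ∀ i j : Fin n, k ≤ i → j < k → L (σ i) (σ j) = 0

instance {n : ℕ} (L : Matrix (Fin n) (Fin n) ℕ) : Decidable (IsReducible L) := by
  unfold IsReducible; infer_instance

/-- `L` has a row equal to zero. -/
def HasZeroRow {n : ℕ} (L : Matrix (Fin n) (Fin n) ℕ) : Prop :=
  ∃ i, ∀ j, L i j = 0

instance {n : ℕ} (L : Matrix (Fin n) (Fin n) ℕ) : Decidable (HasZeroRow L) :=
  @Fintype.decidableExistsFintype (Fin n) (fun i => ∀ j, L i j = 0)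
    (fun i => @Nat.decidableForallFin n (fun j => L i j = 0) (fun j => Nat.decEq (L i j) 0)) _

/-- The principal minor of `M` with rows and columns in `I`. -/
def principalMinor {n : ℕ} (M : Matrix (Fin n) (Fin n) ℤ) (I : Finset (Fin n)) : ℤ :=
  (M.submatrix (fun i : {x // x ∈ I} => i.val) (fun i : {x // x ∈ I} => i.val)).det

/-- A Z-matrix has non-positive off-diagonal entries. -/
def IsZMatrix {n : ℕ} (M : Matrix (Fin n) (Fin n) ℤ) : Prop :=
  ∀ i j, i ≠ j → M i j ≤ 0

/-- An M-matrix is a Z-matrix all of whose principal minors are non-negative. -/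
def IsMMatrix {n : ℕ} (M : Matrix (Fin n) (Fin n) ℤ) : Prop :=
  IsZMatrix M ∧ ∀ I, 0 ≤ principalMinor M I

/-- An M-matrix is almost non-singular if all its proper principal minors are positive. -/
def IsAlmostNonsingMMatrix {n : ℕ} (M : Matrix (Fin n) (Fin n) ℤ) : Prop :=
  IsMMatrix M ∧ ∀ I, I ≠ Finset.univ → 0 < principalMinor M I

/-- `D_{≥0}(L)`: the positive vectors `d` with `Diag(d) - L` an almost non-singular M-matrix. -/
def dGeZero {n : ℕ} (L : Matrix (Fin n) (Fin n) ℕ) : Set (Fin n → ℕ) :=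
  {d | (∀ i, 0 < d i) ∧ IsAlmostNonsingMMatrix (diagSub L d)}

/-- `min D_{≥0}(L)`: the minimal elements for the componentwise order. -/
def minDGeZero {n : ℕ} (L : Matrix (Fin n) (Fin n) ℕ) : Set (Fin n → ℕ) :=
  {d | Minimal (fun x => x ∈ dGeZero L) d}

/-! ### The algorithm computing `min D_{≥0}(L)`

All functions below are executable. -/

/-- The minimal elements of a finite set of vectors. -/
def minimals {n : ℕ} (A : Finset (Fin n → ℕ)) : Finset (Fin n → ℕ) :=
  A.filter (fun x => ∀ y ∈ A, (∀ i, y i ≤ x i) → y = x)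

/-- Increase the `s`-th entry of `d` by one. -/
def bump {n : ℕ} (d : Fin n → ℕ) (s : Fin n) : Fin n → ℕ :=
  Function.update d s (d s + 1)

/-- The set `S` of indices `s` such that the coefficient of `x_s` in
`det(Diag(X + d) - L)` is zero; that coefficient is the minor of `Diag(d) - L` in which the `s`-th
row and column are deleted. -/
def zeroCoefs {n : ℕ} (L : Matrix (Fin n) (Fin n) ℕ) (d : Fin n → ℕ) : Finset (Fin n) :=
  Finset.univ.filter (fun s => principalMinor (diagSub L d) (Finset.univ.erase s) = 0)

/-- The call of `Find` with `k = 1`: increase an entry outside `S`. -/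
def findOne {n : ℕ} (L : Matrix (Fin n) (Fin n) ℕ) (d : Fin n → ℕ) : Finset (Fin n → ℕ) :=
  (zeroCoefs L d)ᶜ.image (bump d)

/-- The procedure `Find`, with `k = |S|`: vectors above `d`, including all minimal ones, at which
all the proper principal minors are positive.  If `k = 0` keep `d`; if `k = 1` increase an entry
outside `S`; otherwise increase an entry outside `S`, or increase an entry in `S` and call `Find`
with `k = 1` on the result. -/
def find {n : ℕ} (L : Matrix (Fin n) (Fin n) ℕ) (d : Fin n → ℕ) : Finset (Fin n → ℕ) :=
  if (zeroCoefs L d).card = 0 then {d}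
  else if (zeroCoefs L d).card = 1 then findOne L d
  else (zeroCoefs L d)ᶜ.image (bump d) ∪
    (zeroCoefs L d).biUnion (fun s => findOne L (bump d s))

/-- The minimal `x ∈ ℕ^n` for which `M + Diag(x)` has non-negative determinant, where
`M = Diag(d) - L`, found by searching the box `[0, max(0, -det M)]^n`.  It is called only at `d`
for which the proper principal minors of `M` are positive. -/
def minCompletions {n : ℕ} (L : Matrix (Fin n) (Fin n) ℕ) (d : Fin n → ℕ) :
    Finset (Fin n → ℕ) :=
  minimals ((Fintype.piFinset
    (fun _ : Fin n => Finset.range ((-(diagSub L d).det).toNat + 1))).filter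
      (fun x => 0 ≤ (diagSub L (d + x)).det))

/-- The recursive step: from `A s`, the output for the matrix with the `s`-th row and column
deleted, for every `s`, to the output for `L`.  Every vector of `A s` gets a new `s`-th entry `1`,
one forms the componentwise maximum `d` of a choice of one such vector for every `s`, and runs
`Find` and the search for minimal completions on `d`; of all the vectors found, the minimal ones
are kept. -/
def stepMinD {n : ℕ} (L : Matrix (Fin (n + 1)) (Fin (n + 1)) ℕ)
    (A : Fin (n + 1) → Finset (Fin n → ℕ)) : Finset (Fin (n + 1) → ℕ) :=
  let As : Fin (n + 1) → Finset (Fin (n + 1) → ℕ) := fun s =>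
    (A s).image (fun d => s.insertNth (α := fun _ => ℕ) 1 d)
  let ds : Finset (Fin (n + 1) → ℕ) :=
    (Fintype.piFinset As).image (fun δ i => Finset.univ.sup (fun s => δ s i))
  minimals ((ds.biUnion (find L)).biUnion
    (fun d => (minCompletions L d).image (fun x => d + x)))

/-- The algorithm computing `min D_{≥0}(L)`, by recursion on the size, with an explicit formula
for matrices of size two. -/
def algMinD : (n : ℕ) → Matrix (Fin n) (Fin n) ℕ → Finset (Fin n → ℕ)
  | 0, _ => {fun _ => 1}
  | 1, _ => {fun _ => 1}
  | 2, L =>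
      minimals ((Finset.Icc 1 (max 1 (L 0 1 * L 1 0))).image
        (fun d => ![d, max 1 ((L 0 1 * L 1 0) ⌈/⌉ d)]))
  | n + 3, L =>
      stepMinD L (fun s => algMinD (n + 2) (L.submatrix s.succAbove s.succAbove))

/-! ### The algorithm computing the `d`-arithmetical structures -/

/-- The output is either a finite list of vectors or the message that there are infinitely many
arithmetical structures. -/
inductive Output (n : ℕ) : Type
  | vectors (D : Finset (Fin n → ℕ)) : Output n
  | infinitelyMany : Output n

/-- The algorithm AA. -/
def algAA {n : ℕ} (L : Matrix (Fin n) (Fin n) ℕ) : Output n :=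
  if ¬ IsReducible L then
    Output.vectors ((algMinD n L).filter (fun d => (diagSub L d).det = 0))
  else if HasZeroRow L then
    Output.vectors ∅
  else
    Output.infinitelyMany

end ArithStruct

/-! Everything rests on one identity: raising the diagonal entry at `s` by `c` adds to the principal
minor on `I ∋ s` exactly `c` times the minor on `I \ {s}` (`minor_add_single`). Hence a minor is
monotone in the diagonal as long as the smaller minors are non-negative, and strictly so in
direction `s` when the minor on `I \ {s}` is positive. In particular a singular element of
`D_{≥0}(L)` has nothing of `D_{≥0}(L)` below it.

For `Min`, deleting an index sends `D_{≥0}(L)` into `D_{≥0}(L_s)`, so each of its elements dominates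
a componentwise maximum `d` of recursive outputs. At such a `d` only the minors of size `n - 1` and
the determinant can fail to be positive, and the former are non-negative (`ProperAlmost`). Raising
entry `t` makes every minor of size `n - 1` that contains `t` positive, so at most two increments
suffice. After that the determinant gains at least one per unit increment, which bounds the search.
Every stage stays below any given target in `D_{≥0}(L)`, and `coe_minimals` concludes.

For irreducible `L`, a positive kernel vector gives a maximum principle for `Diag(d) - tL`, `t ∈ [0,
1]`: the proper minors never vanish and keep the positive sign they have at `t = 0`. Conversely, a
kernel vector of a singular almost non-singular M-matrix has constant sign
(`forall_pos_of_mulVec_eq_zero`), which yields existence and uniqueness of `r`. For reducible `L`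
without zero row, `r` can be scaled on one block at will. -/

namespace ArithStruct

/-! ### Principal minors and perturbations of the diagonal -/

section Minor

variable {ι : Type*} [DecidableEq ι] {R : Type*} [CommRing R]

/-- The principal minor of a matrix over a commutative ring with rows and columns in `I`. -/
def minor (M : Matrix ι ι R) (I : Finset ι) : R :=
  (M.submatrix (fun i : {x // x ∈ I} => i.val) (fun i : {x // x ∈ I} => i.val)).det

theorem minor_congr {M N : Matrix ι ι R} {I : Finset ι}
    (h : ∀ i ∈ I, ∀ j ∈ I, M i j = N i j) : minor M I = minor N I := by
  unfold minor
  congr 1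
  ext i j
  exact h _ i.2 _ j.2

theorem minor_univ [Fintype ι] (M : Matrix ι ι R) : minor M Finset.univ = M.det := by
  have := Matrix.det_submatrix_equiv_self (Equiv.subtypeUnivEquiv (p := fun x : ι => x ∈ Finset.univ)
    Finset.mem_univ) M
  exact this

theorem minor_map {κ : Type*} [DecidableEq κ] (f : κ ↪ ι) (M : Matrix ι ι R) (J : Finset κ) :
    minor (M.submatrix f f) J = minor M (J.map f) := by
  let e : {x // x ∈ J} ≃ {x // x ∈ J.map f} :=
    Equiv.ofBijective (fun x => ⟨f x, Finset.mem_map_of_mem f x.2⟩) <| by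
      constructor
      · intro x y h
        exact Subtype.ext (f.injective (congrArg Subtype.val h))
      · rintro ⟨y, hy⟩
        obtain ⟨x, hx, rfl⟩ := Finset.mem_map.1 hy
        exact ⟨⟨x, hx⟩, rfl⟩
  exact Matrix.det_submatrix_equiv_self e
    (M.submatrix (fun i : {x // x ∈ J.map f} => i.val) (fun i : {x // x ∈ J.map f} => i.val))

theorem det_updateRow_single_one [Fintype ι] (N : Matrix ι ι R) (s : ι) :
    (N.updateRow s (Pi.single s 1)).det =
      (N.submatrix (fun i : {x // x ≠ s} => i.val) (fun i : {x // x ≠ s} => i.val)).det := by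
  rw [Matrix.twoBlockTriangular_det _ (fun i => i ≠ s)]
  · have h1 : (Matrix.toSquareBlockProp (N.updateRow s (Pi.single s 1)) (fun i => ¬ i ≠ s)).det
        = 1 := by
      have hs : Subsingleton {i // ¬ i ≠ s} :=
        ⟨fun a b => Subtype.ext ((not_not.1 a.2).trans (not_not.1 b.2).symm)⟩
      rw [Matrix.det_eq_elem_of_subsingleton _ ⟨s, by simp⟩]
      simp [Matrix.toSquareBlockProp]
    rw [h1, mul_one]
    congr 1
    ext i j
    simp [Matrix.toSquareBlockProp, Matrix.updateRow_ne i.2]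
  · intro i hi j hj
    rw [not_not.1 hi, Matrix.updateRow_self, Pi.single_eq_of_ne hj]

theorem det_add_diagonal_single [Fintype ι] (N : Matrix ι ι R) (s : ι) (c : R) :
    (N + Matrix.diagonal (Pi.single s c)).det = N.det +
      c * (N.submatrix (fun i : {x // x ≠ s} => i.val) (fun i : {x // x ≠ s} => i.val)).det := by
  have h : N + Matrix.diagonal (Pi.single s c)
      = N.updateRow s (N s + c • (Pi.single s 1 : ι → R)) := by
    ext i j
    rcases eq_or_ne i s with rfl | hi
    · rcases eq_or_ne i j with rfl | hj
      · simp
      · simp [Matrix.diagonal_apply_ne _ hj, Pi.single_eq_of_ne hj.symm]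
    · rcases eq_or_ne i j with rfl | hj
      · simp [Matrix.updateRow_ne hi, Pi.single_eq_of_ne hi]
      · simp [Matrix.diagonal_apply_ne _ hj, Matrix.updateRow_ne hi]
  rw [h, Matrix.det_updateRow_add, Matrix.det_updateRow_smul, det_updateRow_single_one,
    Matrix.updateRow_eq_self]

/-- Multilinearity in row `s`: the added row is `c` times a unit vector, whose determinant is the
minor without `s`. -/
theorem minor_add_single (M : Matrix ι ι R) {I : Finset ι} {s : ι} (hs : s ∈ I) (c : R) :
    minor (M + Matrix.diagonal (Pi.single s c)) I = minor M I + c * minor M (I.erase s) := by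
  have h := det_add_diagonal_single
    (M.submatrix (fun i : {x // x ∈ I} => i.val) (fun i : {x // x ∈ I} => i.val)) ⟨s, hs⟩ c
  let e : {x // x ∈ I.erase s} ≃ {x : {x // x ∈ I} // x ≠ ⟨s, hs⟩} :=
    { toFun := fun x => ⟨⟨x, Finset.mem_of_mem_erase x.2⟩,
        fun h => Finset.ne_of_mem_erase x.2 (congrArg Subtype.val h)⟩
      invFun := fun x => ⟨x, Finset.mem_erase.2 ⟨fun h => x.2 (Subtype.ext h), x.1.2⟩⟩
      left_inv := fun _ => rfl
      right_inv := fun _ => rfl }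
  rw [← Matrix.det_submatrix_equiv_self e] at h
  refine Eq.trans ?_ h
  unfold minor
  congr 1
  ext i j
  simp only [Matrix.submatrix_apply, Matrix.add_apply, Matrix.diagonal_apply, Pi.single_apply,
    Subtype.ext_iff]

theorem minor_add_diagonal_congr (M : Matrix ι ι R) {I : Finset ι} {c c' : ι → R}
    (h : ∀ i ∈ I, c i = c' i) :
    minor (M + Matrix.diagonal c) I = minor (M + Matrix.diagonal c') I :=
  minor_congr fun i hi j _ => by simp [Matrix.diagonal_apply, h i hi]

theorem minor_map_ringHom {S : Type*} [CommRing S] (f : R →+* S) (M : Matrix ι ι R)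
    (I : Finset ι) : minor (M.map f) I = f (minor M I) := by
  unfold minor
  rw [RingHom.map_det]
  rfl

variable [PartialOrder R] [IsOrderedRing R]

/-- Increasing the diagonal does not decrease a principal minor, if the smaller principal minors
are non-negative. -/
theorem minor_le_minor_add_diagonal [Fintype ι] {M : Matrix ι ι R} {I : Finset ι}
    (hM : ∀ J, J ⊂ I → 0 ≤ minor M J) {c : ι → R} (hc : ∀ i, 0 ≤ c i) :
    minor M I ≤ minor (M + Matrix.diagonal c) I := by
  -- The entries are raised one at a time, `T` being those already treated. All `J ⊆ I` are handled
  -- together because the step for `J` needs the bound for `J.erase s`.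
  have key : ∀ T : Finset ι, ∀ J, J ⊆ I →
      minor M J ≤ minor (M + Matrix.diagonal (fun i => if i ∈ T then c i else 0)) J := by
    intro T
    induction T using Finset.induction_on with
    | empty => intro J _; simp
    | insert s T hs ih =>
      intro J hJ
      have hd : M + Matrix.diagonal (fun i => if i ∈ insert s T then c i else 0)
          = M + Matrix.diagonal (fun i => if i ∈ T then c i else 0)
            + Matrix.diagonal (Pi.single s (c s)) := by
        rw [add_assoc, Matrix.diagonal_add]
        congr 2
        ext i
        rcases eq_or_ne i s with rfl | hi
        · simp [hs]
        · simp [hi]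
      rw [hd]
      by_cases hsJ : s ∈ J
      · rw [minor_add_single _ hsJ]
        have h1 := ih J hJ
        have h2 := ih (J.erase s) ((Finset.erase_subset _ _).trans hJ)
        have h3 := hM _ ((Finset.erase_ssubset hsJ).trans_subset hJ)
        exact h1.trans (le_add_of_nonneg_right (mul_nonneg (hc s) (h3.trans h2)))
      · refine (ih J hJ).trans (le_of_eq ?_)
        have := minor_add_diagonal_congr
          (M + Matrix.diagonal (fun i => if i ∈ T then c i else 0)) (I := J) (c := 0)
          (c' := Pi.single s (c s)) (fun i hi => by
            rw [Pi.single_eq_of_ne (ne_of_mem_of_not_mem hi hsJ)]; rfl)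
        rw [← this]
        simp
  simpa using key Finset.univ I subset_rfl

/-- Entry `s` is raised last: its coefficient, the minor on `I.erase s`, has by then only grown. -/
theorem minor_add_mul_le_minor_add_diagonal [Fintype ι] {M : Matrix ι ι R} {I : Finset ι}
    (hM : ∀ J, J ⊂ I → 0 ≤ minor M J) {c : ι → R} (hc : ∀ i, 0 ≤ c i) {s : ι} (hs : s ∈ I) :
    minor M I + c s * minor M (I.erase s) ≤ minor (M + Matrix.diagonal c) I := by
  have hc' : ∀ i, 0 ≤ Function.update c s 0 i := by
    intro i
    rcases eq_or_ne i s with rfl | hi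
    · simp
    · simpa [hi] using hc i
  have hd : M + Matrix.diagonal c
      = M + Matrix.diagonal (Function.update c s 0) + Matrix.diagonal (Pi.single s (c s)) := by
    rw [add_assoc, Matrix.diagonal_add]
    congr 2
    ext i
    rcases eq_or_ne i s with rfl | hi
    · simp
    · simp [hi]
  rw [hd, minor_add_single _ hs]
  refine add_le_add (minor_le_minor_add_diagonal hM hc') (mul_le_mul_of_nonneg_left ?_ (hc s))
  exact minor_le_minor_add_diagonal
    (fun J hJ => hM J (hJ.trans (Finset.erase_ssubset hs))) hc'

end Minor

/-! ### Monotonicity of the principal minors of `Diag(d) - L` in `d`. -/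

section DiagSub

variable {n : ℕ} {L : Matrix (Fin n) (Fin n) ℕ} {d d' : Fin n → ℕ} {I : Finset (Fin n)}

theorem principalMinor_eq_minor (M : Matrix (Fin n) (Fin n) ℤ) (I : Finset (Fin n)) :
    principalMinor M I = minor M I := rfl

theorem principalMinor_univ (M : Matrix (Fin n) (Fin n) ℤ) :
    principalMinor M Finset.univ = M.det := minor_univ M

theorem diagSub_apply (i j : Fin n) :
    diagSub L d i j = (if i = j then (d i : ℤ) else 0) - L i j := by
  simp [diagSub, Matrix.diagonal_apply]

theorem diagSub_eq_add_diagonal (L : Matrix (Fin n) (Fin n) ℕ) (d d' : Fin n → ℕ) :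
    diagSub L d' = diagSub L d + Matrix.diagonal (fun i => (d' i : ℤ) - d i) := by
  ext i j
  simp only [diagSub_apply, Matrix.add_apply, Matrix.diagonal_apply]
  split_ifs <;> ring

theorem principalMinor_diagSub_congr (h : ∀ i ∈ I, d i = d' i) :
    principalMinor (diagSub L d) I = principalMinor (diagSub L d') I :=
  minor_congr fun i hi j _ => by simp only [diagSub_apply, h i hi]

theorem principalMinor_diagSub_mono (h : d ≤ d')
    (hd : ∀ J, J ⊂ I → 0 ≤ principalMinor (diagSub L d) J) :
    principalMinor (diagSub L d) I ≤ principalMinor (diagSub L d') I := by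
  rw [diagSub_eq_add_diagonal L d d']
  exact minor_le_minor_add_diagonal hd fun i => sub_nonneg.2 (Int.ofNat_le.2 (h i))

theorem principalMinor_diagSub_add_le (h : d ≤ d')
    (hd : ∀ J, J ⊂ I → 0 ≤ principalMinor (diagSub L d) J) {s : Fin n} (hs : s ∈ I) :
    principalMinor (diagSub L d) I
        + ((d' s : ℤ) - d s) * principalMinor (diagSub L d) (I.erase s)
      ≤ principalMinor (diagSub L d') I := by
  rw [diagSub_eq_add_diagonal L d d']
  exact minor_add_mul_le_minor_add_diagonal hd (fun i => sub_nonneg.2 (Int.ofNat_le.2 (h i))) hs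

theorem principalMinor_diagSub_lt (h : d ≤ d')
    (hd : ∀ J, J ⊂ I → 0 ≤ principalMinor (diagSub L d) J) {s : Fin n} (hs : s ∈ I)
    (hlt : d s < d' s) (hpos : 0 < principalMinor (diagSub L d) (I.erase s)) :
    principalMinor (diagSub L d) I < principalMinor (diagSub L d') I := by
  refine lt_of_lt_of_le ?_ (principalMinor_diagSub_add_le h hd hs)
  exact lt_add_of_pos_right _ (mul_pos (sub_pos.2 (Int.ofNat_lt.2 hlt)) hpos)

theorem isZMatrix_diagSub (L : Matrix (Fin n) (Fin n) ℕ) (d : Fin n → ℕ) :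
    IsZMatrix (diagSub L d) := by
  intro i j hij
  simp [diagSub_apply, hij]

theorem mem_dGeZero_iff : d ∈ dGeZero L ↔ (∀ i, 0 < d i) ∧
    (∀ I, I ≠ Finset.univ → 0 < principalMinor (diagSub L d) I) ∧ 0 ≤ (diagSub L d).det := by
  constructor
  · rintro ⟨h1, h2, h3⟩
    exact ⟨h1, h3, principalMinor_univ (diagSub L d) ▸ h2.2 _⟩
  · rintro ⟨h1, h2, h3⟩
    refine ⟨h1, ⟨isZMatrix_diagSub L d, fun I => ?_⟩, h2⟩
    by_cases hI : I = Finset.univ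
    · rw [hI, principalMinor_univ]; exact h3
    · exact (h2 I hI).le

/-- A singular element of `D_{≥0}(L)` is minimal. -/
theorem mem_minDGeZero_of_det_eq_zero (hd : d ∈ dGeZero L) (h0 : (diagSub L d).det = 0) :
    d ∈ minDGeZero L := by
  refine ⟨hd, fun e he hle => ?_⟩
  by_contra hne
  obtain ⟨s, hs⟩ : ∃ s, e s < d s := by simpa [Pi.le_def] using hne
  obtain ⟨_, he2, he3⟩ := mem_dGeZero_iff.1 he
  -- The determinant increases strictly from `e` to `d`, so it would be negative at `e`.
  have := principalMinor_diagSub_lt (L := L) (I := Finset.univ) hle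
    (fun J hJ => (he2 J hJ.ne).le) (Finset.mem_univ s) hs
    (he2 _ (Finset.erase_ssubset (Finset.mem_univ s)).ne)
  rw [principalMinor_univ, principalMinor_univ, h0] at this
  exact absurd he3 (not_le.2 this)

end DiagSub

/-! ### Correctness of the algorithm computing `min D_{≥0}(L)` -/

/-- Soundness and domination from below are enough: `A` need not contain all of `S`, nor only
minimal elements. -/
theorem coe_minimals {n : ℕ} {A : Finset (Fin n → ℕ)} {S : Set (Fin n → ℕ)}
    (hA : ∀ x ∈ A, x ∈ S) (hS : ∀ x ∈ S, ∃ y ∈ A, y ≤ x) :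
    (minimals A : Set (Fin n → ℕ)) = {x | Minimal (fun x => x ∈ S) x} := by
  ext x
  simp only [minimals, Finset.coe_filter, Set.mem_ofPred_eq]
  constructor
  · rintro ⟨hx, hmin⟩
    refine ⟨hA x hx, fun y hy hyx => ?_⟩
    obtain ⟨z, hz, hzy⟩ := hS y hy
    exact (hmin z hz (hzy.trans hyx)) ▸ hzy
  · intro hx
    obtain ⟨y, hy, hyx⟩ := hS x hx.1
    have : y = x := le_antisymm hyx (hx.2 (hA y hy) hyx)
    exact ⟨this ▸ hy, fun z hz hzx => le_antisymm hzx (hx.2 (hA z hz) hzx)⟩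

theorem le_bump {n : ℕ} (d : Fin n → ℕ) (s : Fin n) : d ≤ bump d s := by
  intro i
  rcases eq_or_ne i s with rfl | hi
  · simp [bump]
  · simp [bump, hi]

theorem bump_self {n : ℕ} (d : Fin n → ℕ) (s : Fin n) : bump d s s = d s + 1 := by
  simp [bump]

theorem bump_of_ne {n : ℕ} (d : Fin n → ℕ) {s i : Fin n} (h : i ≠ s) : bump d s i = d i := by
  simp [bump, h]

theorem bump_le {n : ℕ} {d d' : Fin n → ℕ} (h : d ≤ d') {s : Fin n} (hs : d s < d' s) :
    bump d s ≤ d' := by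
  intro i
  rcases eq_or_ne i s with rfl | hi
  · rw [bump_self]; exact hs
  · rw [bump_of_ne d hi]; exact h i

/-! ### Correctness of `find` and of the bounded search. -/

section Find

variable {n : ℕ} {L : Matrix (Fin n) (Fin n) ℕ} {d d' : Fin n → ℕ}

/-- The matrices `Diag(d) - L` with one row and the corresponding column deleted are all almost
non-singular M-matrices. -/
def ProperAlmost (L : Matrix (Fin n) (Fin n) ℕ) (d : Fin n → ℕ) : Prop :=
  ∀ s I, s ∉ I → 0 ≤ principalMinor (diagSub L d) I ∧
    (I ≠ Finset.univ.erase s → 0 < principalMinor (diagSub L d) I)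

theorem ProperAlmost.mono (hd : ProperAlmost L d) (h : d ≤ d') : ProperAlmost L d' := by
  intro s I hs
  have hm := principalMinor_diagSub_mono (L := L) (I := I) h
    (fun J hJ => (hd s J (fun hsJ => hs (hJ.1 hsJ))).1)
  exact ⟨(hd s I hs).1.trans hm, fun hI => ((hd s I hs).2 hI).trans_le hm⟩

theorem mem_zeroCoefs {s : Fin n} : s ∈ zeroCoefs L d ↔
    principalMinor (diagSub L d) (Finset.univ.erase s) = 0 := by
  simp [zeroCoefs]

theorem ProperAlmost.zeroCoefs_eq_empty_iff (hd : ProperAlmost L d) : zeroCoefs L d = ∅ ↔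
    ∀ I, I ≠ Finset.univ → 0 < principalMinor (diagSub L d) I := by
  constructor
  · intro h I hI
    obtain ⟨s, hs⟩ : ∃ s, s ∉ I := by
      by_contra! hcon
      exact hI (Finset.eq_univ_iff_forall.2 hcon)
    by_cases hIs : I = Finset.univ.erase s
    · refine lt_of_le_of_ne (hd s I hs).1 fun h0 => ?_
      have : s ∈ zeroCoefs L d := mem_zeroCoefs.2 (hIs ▸ h0.symm)
      simp [h] at this
    · exact (hd s I hs).2 hIs
  · intro h
    refine Finset.eq_empty_of_forall_notMem fun s hs => ?_
    exact (h _ (Finset.erase_ssubset (Finset.mem_univ s)).ne).ne' (mem_zeroCoefs.1 hs)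

/-- The minor omitting `s` has, in direction `t`, slope at least the minor omitting both `s` and
`t`, which is already positive. -/
theorem ProperAlmost.notMem_zeroCoefs_of_lt (hd : ProperAlmost L d) (h : d ≤ d') {s t : Fin n}
    (hts : t ≠ s) (hlt : d t < d' t) : s ∉ zeroCoefs L d' := by
  rw [mem_zeroCoefs]
  have ht : t ∈ Finset.univ.erase s := Finset.mem_erase.2 ⟨hts, Finset.mem_univ t⟩
  have hs : s ∉ Finset.univ.erase s := Finset.notMem_erase _ _
  refine ((hd s _ hs).1.trans_lt ?_).ne'
  refine principalMinor_diagSub_lt h (fun J hJ => (hd s J fun hsJ => hs (hJ.1 hsJ)).1) ht hlt ?_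
  exact (hd s _ fun h => hs (Finset.mem_of_mem_erase h)).2 (Finset.erase_ssubset ht).ne

theorem ProperAlmost.zeroCoefs_anti (hd : ProperAlmost L d) (h : d ≤ d') :
    zeroCoefs L d' ⊆ zeroCoefs L d := by
  intro s hs
  rw [mem_zeroCoefs] at hs ⊢
  have hs' : s ∉ Finset.univ.erase s := Finset.notMem_erase _ _
  refine le_antisymm ?_ (hd s _ hs').1
  rw [← hs]
  exact principalMinor_diagSub_mono h fun J hJ => (hd s J fun hsJ => hs' (hJ.1 hsJ)).1

theorem mem_zeroCoefs_congr {s : Fin n} (h : ∀ i, i ≠ s → d i = d' i) :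
    s ∈ zeroCoefs L d ↔ s ∈ zeroCoefs L d' := by
  rw [mem_zeroCoefs, mem_zeroCoefs,
    principalMinor_diagSub_congr fun i hi => h i (Finset.ne_of_mem_erase hi)]

theorem ProperAlmost.findOne_sound (hd : ProperAlmost L d) {s : Fin n} (hs : zeroCoefs L d = {s})
    {e : Fin n → ℕ} (he : e ∈ findOne L d) : d ≤ e ∧ zeroCoefs L e = ∅ := by
  simp only [findOne, hs, Finset.mem_image, Finset.mem_compl, Finset.mem_singleton] at he
  obtain ⟨t, hts, rfl⟩ := he
  refine ⟨le_bump d t, Finset.eq_empty_of_forall_notMem fun u hu => ?_⟩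
  have hus : u = s := by simpa [hs] using hd.zeroCoefs_anti (le_bump d t) hu
  rw [hus] at hu
  exact hd.notMem_zeroCoefs_of_lt (le_bump d t) hts (by simp [bump_self]) hu

/-- The minor omitting `s` does not see entry `s`, so a target where it is nonzero must exceed `d`
at some other index. -/
theorem findOne_complete {s : Fin n} (hs : zeroCoefs L d = {s}) (h : d ≤ d')
    (hd' : zeroCoefs L d' = ∅) : ∃ e ∈ findOne L d, e ≤ d' := by
  obtain ⟨t, hts, ht⟩ : ∃ t, t ≠ s ∧ d t < d' t := by
    by_contra! hcon
    have : s ∈ zeroCoefs L d' :=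
      (mem_zeroCoefs_congr fun i hi => le_antisymm (h i) (hcon i hi)).1 (by simp [hs])
    simp [hd'] at this
  refine ⟨bump d t, ?_, bump_le h ht⟩
  simp only [findOne, hs, Finset.mem_image, Finset.mem_compl, Finset.mem_singleton]
  exact ⟨t, hts, rfl⟩

/-- Raising an entry of `S` repairs every zero minor except its own, which leaves exactly the case
`k = 1` for the second call. -/
theorem ProperAlmost.zeroCoefs_bump (hd : ProperAlmost L d) {s : Fin n} (hs : s ∈ zeroCoefs L d) :
    zeroCoefs L (bump d s) = {s} := by
  ext u
  rw [Finset.mem_singleton]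
  constructor
  · intro hu
    by_contra hus
    exact hd.notMem_zeroCoefs_of_lt (le_bump d s) (Ne.symm hus) (by simp [bump_self]) hu
  · rintro rfl
    exact (mem_zeroCoefs_congr fun i hi => (bump_of_ne d hi).symm).1 hs

theorem ProperAlmost.find_sound (hd : ProperAlmost L d) {e : Fin n → ℕ} (he : e ∈ find L d) :
    d ≤ e ∧ zeroCoefs L e = ∅ := by
  unfold find at he
  split_ifs at he with h0 h1
  · rw [Finset.mem_singleton.1 he]
    exact ⟨le_rfl, Finset.card_eq_zero.1 h0⟩
  · obtain ⟨s, hs⟩ := Finset.card_eq_one.1 h1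
    exact hd.findOne_sound hs he
  · rw [Finset.mem_union, Finset.mem_image, Finset.mem_biUnion] at he
    rcases he with ⟨t, ht, rfl⟩ | ⟨s, hs, he⟩
    · refine ⟨le_bump d t, Finset.eq_empty_of_forall_notMem fun u hu => ?_⟩
      have hu' := hd.zeroCoefs_anti (le_bump d t) hu
      have htu : t ≠ u := by
        rintro rfl
        exact Finset.mem_compl.1 ht hu'
      exact hd.notMem_zeroCoefs_of_lt (le_bump d t) htu (by simp [bump_self]) hu
    · have := (hd.mono (le_bump d s)).findOne_sound (hd.zeroCoefs_bump hs) he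
      exact ⟨(le_bump d s).trans this.1, this.2⟩

theorem ProperAlmost.find_complete (hd : ProperAlmost L d) (h : d ≤ d')
    (hd' : zeroCoefs L d' = ∅) : ∃ e ∈ find L d, e ≤ d' := by
  unfold find
  split_ifs with h0 h1
  · exact ⟨d, Finset.mem_singleton_self d, h⟩
  · obtain ⟨s, hs⟩ := Finset.card_eq_one.1 h1
    exact findOne_complete hs h hd'
  · obtain ⟨t, ht⟩ : ∃ t, d t < d' t := by
      by_contra! hcon
      rw [le_antisymm h hcon, hd'] at h0
      exact h0 rfl
    by_cases htS : t ∈ zeroCoefs L d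
    · obtain ⟨e, he, hle⟩ := findOne_complete (hd.zeroCoefs_bump htS) (bump_le h ht) hd'
      exact ⟨e, Finset.mem_union_right _ (Finset.mem_biUnion.2 ⟨t, htS, he⟩), hle⟩
    · exact ⟨bump d t, Finset.mem_union_left _
        (Finset.mem_image_of_mem _ (Finset.mem_compl.2 htS)), bump_le h ht⟩

theorem coe_minCompletions (hd : ∀ I, I ≠ Finset.univ → 0 < principalMinor (diagSub L d) I) :
    (minCompletions L d : Set (Fin n → ℕ)) =
      {x | Minimal (fun x => x ∈ {x | 0 ≤ (diagSub L (d + x)).det}) x} := by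
  refine coe_minimals (fun x hx => (Finset.mem_filter.1 hx).2) fun x hx => ?_
  obtain ⟨y, hyx, hy⟩ := exists_minimal_le_of_wellFoundedLT
    (fun x => 0 ≤ (diagSub L (d + x)).det) x hx
  refine ⟨y, Finset.mem_filter.2 ⟨Fintype.mem_piFinset.2 fun i => ?_, hy.1⟩, hyx⟩
  rw [Finset.mem_range, Nat.lt_succ_iff]
  -- If `y i > max(0, -det)`, then even with `y i` lowered by one the determinant is at least `det +
  -- (y i - 1) ≥ 0`, since a positive integer minor is at least one. This contradicts minimality.
  by_contra! hlt
  have hpos : 0 < y i := (Nat.zero_le _).trans_lt hlt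
  have hz : ¬ 0 ≤ (diagSub L (d + Function.update y i (y i - 1))).det := by
    intro h0
    have := hy.2 h0 (fun j => by
      rcases eq_or_ne j i with rfl | hj
      · simp
      · simp [hj]) i
    simp only [Function.update_self] at this
    omega
  have hle : d ≤ d + Function.update y i (y i - 1) := le_self_add
  have := principalMinor_diagSub_add_le (L := L) (I := Finset.univ) hle
    (fun J hJ => (hd J hJ.ne).le) (Finset.mem_univ i)
  have hm := hd _ (Finset.erase_ssubset (Finset.mem_univ i)).ne
  rw [principalMinor_univ, principalMinor_univ] at this
  simp only [Pi.add_apply, Function.update_self, Nat.cast_add, add_sub_cancel_left] at this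
  have h2 : ((y i - 1 : ℕ) : ℤ) ≤
      ((y i - 1 : ℕ) : ℤ) * principalMinor (diagSub L d) (Finset.univ.erase i) :=
    le_mul_of_one_le_right (Int.natCast_nonneg _) hm
  omega

end Find

/-! ### The recursive step from the matrices `L_s` to `L`. -/

section Step

variable {n : ℕ} {L : Matrix (Fin (n + 1)) (Fin (n + 1)) ℕ}

theorem principalMinor_diagSub_succAbove (d : Fin (n + 1) → ℕ) (s : Fin (n + 1))
    (J : Finset (Fin n)) :
    principalMinor (diagSub (L.submatrix s.succAbove s.succAbove) (fun i => d (s.succAbove i))) J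
      = principalMinor (diagSub L d) (J.map s.succAboveEmb) := by
  rw [principalMinor_eq_minor, principalMinor_eq_minor, ← minor_map]
  congr 1
  ext i j
  simp [diagSub_apply]

theorem exists_map_succAboveEmb {s : Fin (n + 1)} {I : Finset (Fin (n + 1))} (hs : s ∉ I) :
    ∃ J : Finset (Fin n), J.map s.succAboveEmb = I := by
  refine ⟨Finset.univ.filter (fun i => s.succAbove i ∈ I), ?_⟩
  ext i
  rcases Fin.eq_self_or_eq_succAbove s i with rfl | ⟨j, rfl⟩
  · simp [hs, Fin.succAbove_ne]
  · simp

theorem map_univ_succAboveEmb (s : Fin (n + 1)) :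
    (Finset.univ : Finset (Fin n)).map s.succAboveEmb = Finset.univ.erase s := by
  ext i
  rcases Fin.eq_self_or_eq_succAbove s i with rfl | ⟨j, rfl⟩
  · simp [Fin.succAbove_ne]
  · simp [Fin.succAbove_ne]

/-- An index set avoiding `s` indexes a principal submatrix of `L_s`, where it is proper unless it
is everything but `s`; monotonicity carries the signs from `a` up to `d`. -/
theorem properAlmost_of_succAbove {d : Fin (n + 1) → ℕ}
    (h : ∀ s : Fin (n + 1), ∃ a ∈ dGeZero (L.submatrix s.succAbove s.succAbove),
      a ≤ fun i => d (s.succAbove i)) : ProperAlmost L d := by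
  intro s I hs
  obtain ⟨J, rfl⟩ := exists_map_succAboveEmb hs
  obtain ⟨a, ha, hle⟩ := h s
  rw [← principalMinor_diagSub_succAbove]
  have hm := principalMinor_diagSub_mono (L := L.submatrix s.succAbove s.succAbove) (I := J) hle
    (fun K _ => ha.2.1.2 K)
  refine ⟨(ha.2.1.2 J).trans hm, fun hJ => (ha.2.2 J ?_).trans_le hm⟩
  rintro rfl
  exact hJ (map_univ_succAboveEmb s)

theorem dGeZero_succAbove {d : Fin (n + 1) → ℕ} (hd : d ∈ dGeZero L) (s : Fin (n + 1)) :
    (fun i => d (s.succAbove i)) ∈ dGeZero (L.submatrix s.succAbove s.succAbove) := by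
  obtain ⟨h1, h2, _⟩ := mem_dGeZero_iff.1 hd
  have hpos : ∀ J, 0 < principalMinor
      (diagSub (L.submatrix s.succAbove s.succAbove) (fun i => d (s.succAbove i))) J := by
    intro J
    rw [principalMinor_diagSub_succAbove]
    refine h2 _ fun h => ?_
    have : s ∈ J.map s.succAboveEmb := h ▸ Finset.mem_univ s
    simp [Fin.succAbove_ne] at this
  refine mem_dGeZero_iff.2 ⟨fun i => h1 _, fun J _ => hpos J, ?_⟩
  rw [← principalMinor_univ]
  exact (hpos _).le

theorem coe_stepMinD {A : Fin (n + 1) → Finset (Fin n → ℕ)}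
    (hA : ∀ s, (A s : Set (Fin n → ℕ)) = minDGeZero (L.submatrix s.succAbove s.succAbove)) :
    (stepMinD L A : Set (Fin (n + 1) → ℕ)) = minDGeZero L := by
  have hA' : ∀ s a, a ∈ A s → a ∈ dGeZero (L.submatrix s.succAbove s.succAbove) := by
    intro s a ha
    have : a ∈ minDGeZero (L.submatrix s.succAbove s.succAbove) := hA s ▸ Finset.mem_coe.2 ha
    exact this.1
  unfold stepMinD minDGeZero
  refine coe_minimals (fun y hy => ?_) fun d' hd' => ?_
  · simp only [Finset.mem_biUnion, Finset.mem_image, Fintype.mem_piFinset] at hy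
    obtain ⟨e, ⟨d, ⟨δ, hδ, rfl⟩, he⟩, x, hx, rfl⟩ := hy
    choose a ha haδ using hδ
    have hle : ∀ s i, δ s i ≤ Finset.univ.sup (fun s => δ s i) := fun s i =>
      Finset.le_sup (f := fun s => δ s i) (Finset.mem_univ s)
    have hP : ProperAlmost L (fun i => Finset.univ.sup (fun s => δ s i)) := by
      refine properAlmost_of_succAbove fun s => ⟨a s, hA' s _ (ha s), fun i => ?_⟩
      refine le_trans (le_of_eq ?_) (hle s _)
      rw [← haδ s, Fin.insertNth_apply_succAbove]
    obtain ⟨hde, he0⟩ := hP.find_sound he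
    have hPe := hP.mono hde
    have hpe := hPe.zeroCoefs_eq_empty_iff.1 he0
    have hx' : 0 ≤ (diagSub L (e + x)).det := by
      have : x ∈ (minCompletions L e : Set _) := hx
      rw [coe_minCompletions hpe] at this
      exact this.1
    have hex : e ≤ e + x := le_self_add
    refine mem_dGeZero_iff.2 ⟨fun i => ?_, fun I hI => ?_, hx'⟩
    -- Positivity at `i` comes from the entry `1` inserted into the `i`-th chosen vector.
    · refine lt_of_lt_of_le ?_ ((hle i i).trans ((hde i).trans (hex i)))
      rw [← haδ i, Fin.insertNth_apply_same]
      exact one_pos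
    · refine (hpe I hI).trans_le (principalMinor_diagSub_mono hex fun J hJ => (hpe J ?_).le)
      rintro rfl
      exact hJ.2 (Finset.subset_univ _)
  -- Domination: below each restriction of `d'` lies a minimal element of `D_{≥0}(L_s)`. The maximum
  -- of these, then the output of `find`, then the completion all remain below `d'`.
  · have hex : ∀ s, ∃ a ∈ A s, a ≤ fun i => d' (s.succAbove i) := by
      intro s
      obtain ⟨a, ha, hmin⟩ := exists_minimal_le_of_wellFoundedLT
        (fun x => x ∈ dGeZero (L.submatrix s.succAbove s.succAbove)) _ (dGeZero_succAbove hd' s)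
      refine ⟨a, Finset.mem_coe.1 ?_, ha⟩
      rw [hA s]
      exact hmin
    choose a ha hle using hex
    let δ : Fin (n + 1) → Fin (n + 1) → ℕ := fun s => s.insertNth (α := fun _ => ℕ) 1 (a s)
    have hδ : ∀ s i, δ s i ≤ d' i := by
      intro s i
      rcases Fin.eq_self_or_eq_succAbove s i with rfl | ⟨j, rfl⟩
      · simp only [δ, Fin.insertNth_apply_same]
        exact hd'.1 i
      · simp only [δ, Fin.insertNth_apply_succAbove]
        exact hle s j
    have hsup : (fun i => Finset.univ.sup (fun s => δ s i)) ≤ d' := fun i =>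
      Finset.sup_le fun s _ => hδ s i
    have hP : ProperAlmost L (fun i => Finset.univ.sup (fun s => δ s i)) := by
      refine properAlmost_of_succAbove fun s => ⟨a s, hA' s _ (ha s), fun i => ?_⟩
      refine le_trans (le_of_eq ?_)
        (Finset.le_sup (f := fun s' => δ s' (s.succAbove i)) (Finset.mem_univ s))
      simp only [δ, Fin.insertNth_apply_succAbove]
    obtain ⟨h1, h2, h3⟩ := mem_dGeZero_iff.1 hd'
    obtain ⟨e, he, hed⟩ := hP.find_complete hsup ((hP.mono hsup).zeroCoefs_eq_empty_iff.2 h2)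
    obtain ⟨hde, he0⟩ := hP.find_sound he
    have hpe := (hP.mono hde).zeroCoefs_eq_empty_iff.1 he0
    obtain ⟨x, hx, hmin⟩ := exists_minimal_le_of_wellFoundedLT
      (fun x => x ∈ {x | 0 ≤ (diagSub L (e + x)).det}) (d' - e)
      (by rw [Set.mem_ofPred_eq, add_tsub_cancel_of_le hed]; exact h3)
    refine ⟨e + x, ?_, ?_⟩
    · simp only [Finset.mem_biUnion, Finset.mem_image, Fintype.mem_piFinset]
      refine ⟨e, ⟨_, ⟨δ, fun s => ⟨a s, ha s, rfl⟩, rfl⟩, he⟩, x, ?_, rfl⟩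
      rw [← Finset.mem_coe, coe_minCompletions hpe]
      exact hmin
    · calc e + x ≤ e + (d' - e) := add_le_add_right hx e
        _ = d' := add_tsub_cancel_of_le hed

end Step

/-! ### Sizes one and two, and the recursion. -/

theorem mem_dGeZero_one_iff {L : Matrix (Fin 1) (Fin 1) ℕ} (hL : ∀ i, L i i = 0)
    {d : Fin 1 → ℕ} : d ∈ dGeZero L ↔ 0 < d 0 := by
  rw [mem_dGeZero_iff]
  constructor
  · exact fun h => h.1 0
  · intro h
    refine ⟨fun i => Subsingleton.elim 0 i ▸ h, fun I hI => ?_, ?_⟩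
    · have hI' : I = ∅ := by
        refine Finset.eq_empty_of_forall_notMem fun i hi => hI ?_
        exact Finset.eq_univ_iff_forall.2 fun j => Subsingleton.elim i j ▸ hi
      subst hI'
      have : principalMinor (diagSub L d) ∅ = 1 := Matrix.det_isEmpty
      rw [this]; exact one_pos
    · simp [diagSub_apply, hL]

theorem mem_dGeZero_two_iff {L : Matrix (Fin 2) (Fin 2) ℕ} (hL : ∀ i, L i i = 0)
    {d : Fin 2 → ℕ} : d ∈ dGeZero L ↔ 0 < d 0 ∧ 0 < d 1 ∧ L 0 1 * L 1 0 ≤ d 0 * d 1 := by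
  have hdet : (diagSub L d).det = (d 0 : ℤ) * d 1 - L 0 1 * L 1 0 := by
    simp [Matrix.det_fin_two, diagSub_apply, hL]
  rw [mem_dGeZero_iff, hdet, sub_nonneg]
  constructor
  · rintro ⟨h1, _, h3⟩
    exact ⟨h1 0, h1 1, by exact_mod_cast h3⟩
  · rintro ⟨h0, h1, h⟩
    have hpos : ∀ i, 0 < d i := Fin.forall_fin_two.2 ⟨h0, h1⟩
    refine ⟨hpos, fun I hI => ?_, by exact_mod_cast h⟩
    have hsub : Subsingleton {x // x ∈ I} := by
      have : I.card ≤ 1 := by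
        have h := Finset.card_lt_card (Finset.ssubset_univ_iff.2 hI)
        simp at h
        omega
      exact ⟨fun a b => Subtype.ext (Finset.card_le_one.1 this a a.2 b b.2)⟩
    unfold principalMinor
    rcases isEmpty_or_nonempty {x // x ∈ I} with he | ⟨⟨k⟩⟩
    · rw [Matrix.det_isEmpty]; exact one_pos
    · rw [Matrix.det_eq_elem_of_subsingleton _ k]
      simp [diagSub_apply, hL, hpos]

/-- The algorithm computes `min D_{≥0}(L)`. -/
theorem coe_algMinD : ∀ {n : ℕ}, 0 < n → ∀ L : Matrix (Fin n) (Fin n) ℕ, (∀ i, L i i = 0) →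
    (algMinD n L : Set (Fin n → ℕ)) = minDGeZero L
  | 1, _, L, hL => by
    ext d
    simp only [algMinD, Finset.coe_singleton, Set.mem_singleton_iff, minDGeZero, Set.mem_ofPred_eq]
    constructor
    · rintro rfl
      refine ⟨(mem_dGeZero_one_iff hL).2 one_pos, fun e he _ i => ?_⟩
      exact he.1 i
    · intro hd
      have h1 : (fun _ => 1) ≤ d := fun i => hd.1.1 i
      exact le_antisymm (hd.2 ((mem_dGeZero_one_iff hL).2 one_pos) h1) h1
  | 2, _, L, hL => by
    unfold algMinD minDGeZero
    refine coe_minimals (fun x hx => ?_) fun x hx => ?_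
    · obtain ⟨d, hd, rfl⟩ := Finset.mem_image.1 hx
      have hd1 : 0 < d := (Finset.mem_Icc.1 hd).1
      refine (mem_dGeZero_two_iff hL).2 ⟨hd1, by simp, ?_⟩
      have h := le_smul_ceilDiv (b := L 0 1 * L 1 0) hd1
      rw [smul_eq_mul] at h
      exact h.trans (Nat.mul_le_mul_left d (le_max_right 1 _))
    · obtain ⟨h0, h1, h⟩ := (mem_dGeZero_two_iff hL).1 hx
      set p := L 0 1 * L 1 0 with hp
      -- The first entry is truncated at `max 1 p`: from there on any positive second entry already
      -- gives a product of at least `p`.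
      refine ⟨_, Finset.mem_image_of_mem _ (Finset.mem_Icc.2
        (⟨le_min h0 (le_max_left 1 p), min_le_right _ _⟩ :
          1 ≤ min (x 0) (max 1 p) ∧ min (x 0) (max 1 p) ≤ max 1 p)), ?_⟩
      refine Fin.forall_fin_two.2 ⟨min_le_left _ _, max_le h1 ?_⟩
      have hm : 0 < min (x 0) (max 1 p) := lt_min h0 (lt_max_of_lt_left one_pos)
      rw [ceilDiv_le_iff_le_smul hm, smul_eq_mul]
      rcases le_total (x 0) (max 1 p) with hc | hc
      · rw [min_eq_left hc]; exact h
      · rw [min_eq_right hc]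
        exact (le_max_right 1 p).trans (Nat.le_mul_of_pos_right _ h1)
  | n + 3, _, L, hL => by
    unfold algMinD
    exact coe_stepMinD fun s => coe_algMinD (Nat.succ_pos _) _ fun i => hL _

/-! ### Arithmetical structures on irreducible matrices -/

section Structures

variable {n : ℕ} {L : Matrix (Fin n) (Fin n) ℕ} {d r : Fin n → ℕ}

theorem diagSub_mulVec_apply (v : Fin n → ℤ) (i : Fin n) :
    (diagSub L d).mulVec v i = d i * v i - ∑ j, (L i j : ℤ) * v j := by
  simp only [diagSub, Matrix.sub_mulVec, Pi.sub_apply, Matrix.mulVec_diagonal]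
  rfl

theorem isReducible_of_closed {J : Finset (Fin n)} (hne : J.Nonempty) (hJ : J ≠ Finset.univ)
    (h : ∀ i ∈ J, ∀ j, j ∉ J → L i j = 0) : IsReducible L := by
  have hcard : Jᶜ.card < n := by
    have := Finset.card_compl_add_card J
    have := hne.card_pos
    simp only [Fintype.card_fin] at *
    omega
  have hpos : 0 < Jᶜ.card := by
    rw [Finset.card_pos, Finset.nonempty_iff_ne_empty, Ne, Finset.compl_eq_empty_iff]
    exact hJ
  -- The permutation lists `Jᶜ` first and `J` last, so the vanishing block has rows in `J` and
  -- columns in `Jᶜ`.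
  have hc : Fintype.card {i : Fin n // i < ⟨Jᶜ.card, hcard⟩} = Fintype.card {i // i ∈ Jᶜ} := by
    rw [Fintype.card_coe, Fintype.card_subtype]
    refine Eq.trans ?_ (Fin.card_Iio (⟨Jᶜ.card, hcard⟩ : Fin n))
    congr 1
    ext i
    simp
  let e := Fintype.equivOfCardEq hc
  refine ⟨⟨Jᶜ.card, hcard⟩, hpos, e.extendSubtype, fun i j hi hj => h _ ?_ _ ?_⟩
  · have := e.extendSubtype_not_mem i (not_lt.2 hi)
    simpa using this
  · have := e.extendSubtype_mem j hj
    simpa using this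

/-- Maximum principle: if `L` is irreducible and `(Diag(d) - L) r = 0` with `r` positive, then no
proper principal submatrix of `Diag(d) - t L`, for `t ∈ [0, 1]`, is singular. -/
theorem minor_diagonal_sub_smul_ne_zero (hL : ¬ IsReducible L) (hr : ∀ i, 0 < r i)
    (h : ∀ i, (d i : ℝ) * r i = ∑ j, (L i j : ℝ) * r j) {I : Finset (Fin n)}
    (hI : I ≠ Finset.univ) {t : ℝ} (ht0 : 0 ≤ t) (ht1 : t ≤ 1) :
    minor (Matrix.diagonal (fun i => (d i : ℝ)) - t • L.map (fun a => (a : ℝ))) I ≠ 0 := by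
  intro h0
  obtain ⟨v, hv0, hv⟩ := Matrix.exists_mulVec_eq_zero_iff.2 h0
  -- The kernel vector is extended by zero outside `I`, then compared with the positive vector `r`.
  let w : Fin n → ℝ := fun i => if hi : i ∈ I then v ⟨i, hi⟩ else 0
  have hwv : ∀ i : {x // x ∈ I}, w i = v i := fun i => by simp [w]
  have hw0 : ∀ i, i ∉ I → w i = 0 := fun i hi => by simp [w, hi]
  have hw : ∀ i ∈ I, (d i : ℝ) * w i = t * ∑ j, (L i j : ℝ) * w j := by
    intro i hi
    have h1 := congrFun hv ⟨i, hi⟩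
    simp only [Matrix.mulVec, dotProduct, Matrix.submatrix_apply, Matrix.sub_apply,
      Matrix.smul_apply, Matrix.map_apply, smul_eq_mul, Pi.zero_apply, ← hwv] at h1
    rw [Finset.sum_coe_sort I (fun j => (Matrix.diagonal (fun i => (d i : ℝ)) i j
      - t * (L i j : ℝ)) * w j)] at h1
    rw [Finset.sum_subset (Finset.subset_univ I) (fun j _ hj => by rw [hw0 j hj, mul_zero])] at h1
    simp only [sub_mul, Finset.sum_sub_distrib, Matrix.diagonal_apply, ite_mul, zero_mul,
      Finset.sum_ite_eq, Finset.mem_univ, if_true] at h1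
    rw [Finset.mul_sum, sub_eq_zero.1 h1]
    exact Finset.sum_congr rfl fun j _ => by ring
  obtain ⟨i₁, hi₁⟩ : ∃ i, v i ≠ 0 := Function.ne_iff.1 hv0
  have hrpos : ∀ i, (0 : ℝ) < r i := fun i => Nat.cast_pos.2 (hr i)
  obtain ⟨i₀, -, hmax⟩ := Finset.exists_max_image Finset.univ (fun i => |w i| / r i)
    ⟨i₁.1, Finset.mem_univ _⟩
  set m := |w i₀| / r i₀ with hm
  have hle : ∀ i, |w i| ≤ m * r i := fun i =>
    (div_le_iff₀ (hrpos i)).1 (hmax i (Finset.mem_univ i))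
  have hmpos : 0 < m := by
    refine lt_of_lt_of_le ?_ (hmax i₁ (Finset.mem_univ _))
    exact div_pos (abs_pos.2 (by rwa [hwv])) (hrpos _)
  -- `J` is where `|w i| / r i` attains its maximum `m > 0`; it avoids the zeros of `w`, so it is
  -- proper. Irreducibility gives a nonzero entry of `L` leaving `J`, and in that row the triangle
  -- inequality becomes strict.
  let J := Finset.univ.filter (fun i => |w i| = m * r i)
  have hJI : J ⊆ I := by
    intro i hi
    by_contra hiI
    have := (Finset.mem_filter.1 hi).2
    rw [hw0 i hiI, abs_zero] at this
    exact (mul_pos hmpos (hrpos i)).ne this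
  have hJ : ∃ i ∈ J, ∃ j, j ∉ J ∧ L i j ≠ 0 := by
    by_contra! hcon
    refine hL (isReducible_of_closed (J := J) ⟨i₀, ?_⟩ ?_ hcon)
    · exact Finset.mem_filter.2 ⟨Finset.mem_univ _, by rw [hm, div_mul_cancel₀ _ (hrpos _).ne']⟩
    · intro hJu
      exact hI (Finset.univ_subset_iff.1 (hJu ▸ hJI))
  obtain ⟨i, hi, j, hj, hij⟩ := hJ
  have hwi : |w i| = m * r i := (Finset.mem_filter.1 hi).2
  have hwj : |w j| < m * r j := lt_of_le_of_ne (hle j) fun h => hj (by simp [J, h])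
  have hlt : ∑ k, (L i k : ℝ) * |w k| < ∑ k, (L i k : ℝ) * (m * r k) :=
    Finset.sum_lt_sum (fun k _ => mul_le_mul_of_nonneg_left (hle k) (Nat.cast_nonneg _))
      ⟨j, Finset.mem_univ j, mul_lt_mul_of_pos_left hwj
        (Nat.cast_pos.2 (Nat.pos_of_ne_zero hij))⟩
  have hsum : ∑ k, (L i k : ℝ) * (m * r k) = d i * |w i| := by
    rw [hwi, mul_left_comm, h i, Finset.mul_sum]
    exact Finset.sum_congr rfl fun k _ => by ring
  have habs : d i * |w i| ≤ ∑ k, (L i k : ℝ) * |w k| := by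
    calc d i * |w i| = |(d i : ℝ) * w i| := by rw [abs_mul, Nat.abs_cast]
      _ = t * |∑ k, (L i k : ℝ) * w k| := by rw [hw i (hJI hi), abs_mul, abs_of_nonneg ht0]
      _ ≤ |∑ k, (L i k : ℝ) * w k| := mul_le_of_le_one_left (abs_nonneg _) ht1
      _ ≤ ∑ k, |(L i k : ℝ) * w k| := Finset.abs_sum_le_sum_abs _ _
      _ = ∑ k, (L i k : ℝ) * |w k| := by simp only [abs_mul, Nat.abs_cast]
  linarith

/-- Deform `Diag(d)` to `Diag(d) - L` through `Diag(d) - tL`: the minor starts as a product of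
positive numbers and never vanishes, so the intermediate value theorem fixes its sign. -/
theorem principalMinor_pos_of_mem_structures (hL : ¬ IsReducible L) (h : (d, r) ∈ structures L)
    {I : Finset (Fin n)} (hI : I ≠ Finset.univ) : 0 < principalMinor (diagSub L d) I := by
  obtain ⟨hd, hr, hM, -⟩ := h
  simp only at hd hr hM
  have h : ∀ i, (d i : ℝ) * r i = ∑ j, (L i j : ℝ) * r j := by
    intro i
    have := congrFun hM i
    rw [diagSub_mulVec_apply, Pi.zero_apply, sub_eq_zero] at this
    exact_mod_cast this
  let g : ℝ → ℝ := fun t =>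
    minor (Matrix.diagonal (fun i => (d i : ℝ)) - t • L.map (fun a => (a : ℝ))) I
  have hg : Continuous g := by
    refine Continuous.matrix_det (Continuous.matrix_submatrix ?_ _ _)
    fun_prop
  have hg0 : 0 < g 0 := by
    have : g 0 = ∏ i : {x // x ∈ I}, (d i : ℝ) := by
      simp only [g, zero_smul, sub_zero, minor]
      rw [Matrix.submatrix_diagonal _ _ Subtype.val_injective, Matrix.det_diagonal]
      rfl
    rw [this]
    exact Finset.prod_pos fun i _ => Nat.cast_pos.2 (hd i)
  have hg1 : g 1 = ((principalMinor (diagSub L d) I : ℤ) : ℝ) := by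
    rw [principalMinor_eq_minor]
    refine Eq.trans ?_ (minor_map_ringHom (Int.castRingHom ℝ) (diagSub L d) I)
    refine minor_congr fun i _ j _ => ?_
    by_cases hij : i = j
    · subst hij; simp [diagSub_apply]
    · simp [diagSub_apply, hij]
  have hpos : 0 < g 1 := by
    by_contra! hcon
    obtain ⟨t, ht, h0⟩ := intermediate_value_Icc' zero_le_one hg.continuousOn ⟨hcon, hg0.le⟩
    exact minor_diagonal_sub_smul_ne_zero hL hr h hI ht.1 ht.2 h0
  rw [hg1] at hpos
  exact_mod_cast hpos

/-- A kernel vector of `Diag(d) - L` with a positive entry is positive, if the proper principal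
minors of `Diag(d) - L` are positive. -/
theorem forall_pos_of_mulVec_eq_zero
    (hd : ∀ I, I ≠ Finset.univ → 0 < principalMinor (diagSub L d) I) {v : Fin n → ℤ}
    (hv : (diagSub L d).mulVec v = 0) (hpos : ∃ i, 0 < v i) (i : Fin n) : 0 < v i := by
  let P := Finset.univ.filter (fun i => 0 < v i)
  have hmem : ∀ i, i ∈ P ↔ 0 < v i := fun i => by simp [P]
  suffices hP : P = Finset.univ from (hmem i).1 (hP ▸ Finset.mem_univ i)
  by_contra hP
  let A : Matrix (Fin n) (Fin n) ℚ := (diagSub L d).map (Int.castRingHom ℚ)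
  have hA : ∀ I, minor A I = (principalMinor (diagSub L d) I : ℚ) := fun I =>
    minor_map_ringHom (Int.castRingHom ℚ) (diagSub L d) I
  -- In a row of `P`, the terms of the kernel equation outside `P` are absorbed into the diagonal.
  -- As `v ≤ 0` outside `P`, this increment is non-negative, while `v` restricted to `P` is killed.
  -- Monotonicity then forces the minor on `P` to be at most zero.
  let c : Fin n → ℚ := fun i =>
    if 0 < v i then (∑ j ∈ Pᶜ, (L i j : ℚ) * (-v j)) / v i else 0
  have hc : ∀ i, 0 ≤ c i := by
    intro i
    simp only [c]
    split_ifs with hi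
    · refine div_nonneg (Finset.sum_nonneg fun j hj => ?_) (by exact_mod_cast hi.le)
      rw [Finset.mem_compl, hmem, not_lt] at hj
      refine mul_nonneg (Nat.cast_nonneg _) ?_
      rw [neg_nonneg]
      exact_mod_cast hj
    · exact le_rfl
  have hle := minor_le_minor_add_diagonal (M := A) (I := P) (fun J hJ => by
    rw [hA]
    refine Int.cast_nonneg (hd J ?_).le
    rintro rfl
    exact hJ.2 (Finset.subset_univ _)) hc
  have hzero : minor (A + Matrix.diagonal c) P = 0 := by
    refine Matrix.exists_mulVec_eq_zero_iff.1 ⟨fun i => (v i : ℚ), ?_, ?_⟩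
    · obtain ⟨i, hi⟩ := hpos
      refine Function.ne_iff.2 ⟨⟨i, (hmem i).2 hi⟩, ?_⟩
      exact Int.cast_ne_zero.2 hi.ne'
    · ext ⟨i, hi⟩
      have hvi := (hmem i).1 hi
      have hvi' : (v i : ℚ) ≠ 0 := by exact_mod_cast hvi.ne'
      have hker : (d i : ℚ) * v i = ∑ j, (L i j : ℚ) * v j := by
        have := congrFun hv i
        rw [diagSub_mulVec_apply, Pi.zero_apply, sub_eq_zero] at this
        exact_mod_cast this
      simp only [Matrix.mulVec, dotProduct, Matrix.submatrix_apply, Pi.zero_apply]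
      rw [Finset.sum_coe_sort P (fun j => (A + Matrix.diagonal c) i j * (v j : ℚ))]
      have hentry : ∀ j, (A + Matrix.diagonal c) i j * (v j : ℚ)
          = (if i = j then ((d i : ℚ) + c i) * v j else 0) - (L i j : ℚ) * v j := by
        intro j
        by_cases hij : i = j
        · subst hij; simp [A, diagSub_apply]; ring
        · simp [A, diagSub_apply, hij]
      have hci : c i * v i = - ∑ j ∈ Pᶜ, (L i j : ℚ) * v j := by
        simp only [c, if_pos hvi]
        rw [div_mul_cancel₀ _ hvi', ← Finset.sum_neg_distrib]
        exact Finset.sum_congr rfl fun j _ => by ring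
      simp only [hentry, Finset.sum_sub_distrib, Finset.sum_ite_eq, hi, if_true]
      rw [add_mul, hker, hci, ← Finset.sum_add_sum_compl P (fun j => (L i j : ℚ) * v j)]
      ring
  rw [hzero, hA] at hle
  have := hd P hP
  exact absurd (by exact_mod_cast hle) (not_le.2 this)

theorem det_eq_zero_of_mem_structures (hn : 0 < n) (h : (d, r) ∈ structures L) :
    (diagSub L d).det = 0 := by
  refine Matrix.exists_mulVec_eq_zero_iff.1 ⟨_, ?_, h.2.2.1⟩
  refine Function.ne_iff.2 ⟨⟨0, hn⟩, ?_⟩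
  exact Nat.cast_ne_zero.2 (h.2.1 ⟨0, hn⟩).ne'

theorem exists_mem_structures (hd : d ∈ dGeZero L) (h0 : (diagSub L d).det = 0) :
    ∃ r, (d, r) ∈ structures L := by
  obtain ⟨hpos, hminor, -⟩ := mem_dGeZero_iff.1 hd
  obtain ⟨v, hv, hker, i₀, hi₀⟩ :
      ∃ v : Fin n → ℤ, v ≠ 0 ∧ (diagSub L d).mulVec v = 0 ∧ ∃ i, 0 < v i := by
    obtain ⟨v, hv, hker⟩ := Matrix.exists_mulVec_eq_zero_iff.2 h0
    obtain ⟨i, hi⟩ := Function.ne_iff.1 hv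
    rcases lt_or_gt_of_ne hi with hlt | hgt
    · exact ⟨-v, neg_ne_zero.2 hv, by rw [Matrix.mulVec_neg, hker, neg_zero], i, neg_pos.2 hlt⟩
    · exact ⟨v, hv, hker, i, hgt⟩
  have hvpos := forall_pos_of_mulVec_eq_zero hminor hker ⟨i₀, hi₀⟩
  -- All entries of `v` are positive, so `toNat` loses nothing.
  obtain ⟨r, hr, hgcd⟩ := Finset.extract_gcd (s := Finset.univ) (fun i => (v i).toNat)
    ⟨i₀, Finset.mem_univ _⟩
  set g := Finset.univ.gcd (fun i => (v i).toNat)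
  have hvr : ∀ i, v i = g * r i := by
    intro i
    have := hr i (Finset.mem_univ i)
    have h2 := hvpos i
    zify at this
    rw [← this]
    omega
  have hg : (g : ℤ) ≠ 0 := by
    intro hg
    have := hvr i₀
    rw [hg, zero_mul] at this
    omega
  refine ⟨r, hpos, fun i => Nat.pos_of_ne_zero fun h => ?_, ?_, hgcd⟩
  · have h1 := hvr i
    simp only at h
    rw [h, Nat.cast_zero, mul_zero] at h1
    exact (hvpos i).ne' h1
  · have : v = (g : ℤ) • fun i => (r i : ℤ) := funext hvr
    rw [this, Matrix.mulVec_smul] at hker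
    exact (smul_eq_zero.1 hker).resolve_left hg

theorem mem_structures_unique (hn : 0 < n) (hd : d ∈ dGeZero L) {r r' : Fin n → ℕ}
    (h : (d, r) ∈ structures L) (h' : (d, r') ∈ structures L) : r' = r := by
  obtain ⟨-, hminor, -⟩ := mem_dGeZero_iff.1 hd
  let i₀ : Fin n := ⟨0, hn⟩
  -- This combination vanishes at `i₀`. A positive entry of `w` or of `-w` would make all its
  -- entries positive, so `w = 0` and `r`, `r'` are proportional; the gcd condition then makes them
  -- equal.
  let w : Fin n → ℤ := (r' i₀ : ℤ) • (fun i => (r i : ℤ)) - (r i₀ : ℤ) • (fun i => (r' i : ℤ))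
  have hw : (diagSub L d).mulVec w = 0 := by
    simp only [w, Matrix.mulVec_sub, Matrix.mulVec_smul]
    rw [h.2.2.1, h'.2.2.1]
    simp
  have hwi₀ : w i₀ = 0 := by simp [w]; ring
  have hw0 : ∀ i, w i = 0 := by
    intro i
    by_contra hi
    rcases lt_or_gt_of_ne hi with hlt | hgt
    · have := forall_pos_of_mulVec_eq_zero hminor (v := -w)
        (by rw [Matrix.mulVec_neg, hw, neg_zero]) ⟨i, neg_pos.2 hlt⟩ i₀
      simp [hwi₀] at this
    · have := forall_pos_of_mulVec_eq_zero hminor hw ⟨i, hgt⟩ i₀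
      exact this.ne' hwi₀
  have hprop : ∀ i, r' i₀ * r i = r i₀ * r' i := by
    intro i
    have := sub_eq_zero.1 (hw0 i)
    simp only [Pi.smul_apply, smul_eq_mul] at this
    exact_mod_cast this
  have hgcd := Finset.gcd_mul_left (s := Finset.univ) (f := r) (a := r' i₀)
  rw [funext hprop, Finset.gcd_mul_left, h.2.2.2, h'.2.2.2] at hgcd
  simp only [normalize_eq, mul_one] at hgcd
  ext i
  have := hprop i
  rw [hgcd] at this
  exact (Nat.eq_of_mul_eq_mul_left (h'.2.1 i₀) this).symm

theorem dStructures_eq (hn : 0 < n) (hL : ¬ IsReducible L) :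
    dStructures L = {d | d ∈ minDGeZero L ∧ (diagSub L d).det = 0} := by
  ext d
  constructor
  · rintro ⟨r, h⟩
    have h0 := det_eq_zero_of_mem_structures hn h
    refine ⟨mem_minDGeZero_of_det_eq_zero (mem_dGeZero_iff.2 ⟨h.1, fun I hI =>
      principalMinor_pos_of_mem_structures hL h hI, h0.ge⟩) h0, h0⟩
  · rintro ⟨h, h0⟩
    exact exists_mem_structures h.1 h0

/-! ### Zero rows and reducible matrices -/

theorem structures_eq_empty (h : HasZeroRow L) : structures L = ∅ := by
  obtain ⟨i, hi⟩ := h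
  refine Set.eq_empty_of_forall_notMem ?_
  rintro ⟨d, r⟩ ⟨hd, hr, hM, -⟩
  have := congrFun hM i
  rw [diagSub_mulVec_apply] at this
  simp only [hi, Nat.cast_zero, zero_mul, Finset.sum_const_zero, sub_zero, Pi.zero_apply] at this
  have h1 := hd i
  have h2 := hr i
  exact (Nat.mul_pos h1 h2).ne' (by exact_mod_cast this)

theorem dStructures_eq_empty (h : HasZeroRow L) : dStructures L = ∅ := by
  refine Set.eq_empty_of_forall_notMem ?_
  rintro d ⟨r, hr⟩
  rw [structures_eq_empty h] at hr
  exact hr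

/-- Rows of the block `k ≤ σ.symm i` see only that block, where `r` is constant, so their row sum
serves as `d i` for every `c`. Elsewhere `r i = 1`, and `d i` can be read off the equation. An entry
`1` of `r` forces the gcd, and `d` is positive because no row is zero. -/
theorem infinite_structures (hL : IsReducible L) (hrow : ¬ HasZeroRow L) :
    (structures L).Infinite := by
  obtain ⟨k, hk, σ, hσ⟩ := hL
  have hn : 0 < n := hk.trans k.2
  let r : ℕ → Fin n → ℕ := fun c i => if k ≤ σ.symm i then c + 1 else 1
  let d : ℕ → Fin n → ℕ := fun c i => if k ≤ σ.symm i then ∑ j, L i j else ∑ j, L i j * r c j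
  have hr : ∀ c i, 0 < r c i := by
    intro c i
    simp only [r]
    split_ifs <;> omega
  have hsum : ∀ i, ∃ j, 0 < L i j := by
    intro i
    by_contra! hcon
    exact hrow ⟨i, fun j => Nat.le_zero.1 (hcon j)⟩
  refine Set.infinite_of_injective_forall_mem (f := fun c => (d c, r c)) ?_ fun c => ?_
  · intro c c' h
    have := congrFun (congrArg Prod.snd h) (σ k)
    simpa [r] using this
  · refine ⟨fun i => ?_, hr c, ?_, ?_⟩
    · obtain ⟨j, hj⟩ := hsum i
      simp only [d]
      split_ifs
      · exact Finset.sum_pos' (fun _ _ => Nat.zero_le _) ⟨j, Finset.mem_univ j, hj⟩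
      · exact Finset.sum_pos' (fun _ _ => Nat.zero_le _)
          ⟨j, Finset.mem_univ j, Nat.mul_pos hj (hr c j)⟩
    · ext i
      rw [diagSub_mulVec_apply, Pi.zero_apply, sub_eq_zero]
      have : d c i * r c i = ∑ j, L i j * r c j := by
        by_cases hi : k ≤ σ.symm i
        · simp only [d, if_pos hi, Finset.sum_mul]
          refine Finset.sum_congr rfl fun j _ => ?_
          by_cases hj : k ≤ σ.symm j
          · simp only [r, if_pos hi, if_pos hj]
          · have := hσ (σ.symm i) (σ.symm j) hi (not_le.1 hj)
            simp only [Equiv.apply_symm_apply] at this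
            simp [this]
        · simp only [d, if_neg hi]
          simp [r, hi]
      exact_mod_cast this
    · have h1 : r c (σ ⟨0, hn⟩) = 1 := by
        have : ¬ k ≤ ⟨0, hn⟩ := not_le.2 hk
        simp [r, this]
      have := Finset.gcd_dvd (s := Finset.univ) (f := r c) (Finset.mem_univ (σ ⟨0, hn⟩))
      rw [h1] at this
      exact Nat.dvd_one.1 this

theorem algAA_eq_of_hasZeroRow (hn : 0 < n) (hL : ∀ i, L i i = 0) (h : HasZeroRow L) :
    algAA L = Output.vectors ∅ := by
  unfold algAA
  by_cases hred : IsReducible L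
  · simp [hred, h]
  -- This branch does occur: the zero matrix of size one is irreducible and has a zero row.
  · rw [if_pos hred]
    congr 1
    refine Finset.eq_empty_of_forall_notMem fun d hd => ?_
    obtain ⟨h1, h2⟩ := Finset.mem_filter.1 hd
    have : d ∈ dStructures L := by
      rw [dStructures_eq hn hred]
      exact ⟨coe_algMinD hn L hL ▸ Finset.mem_coe.2 h1, h2⟩
    rw [dStructures_eq_empty h] at this
    exact this

end Structures

end ArithStruct

/-! ### Correctness of both algorithms. -/

open ArithStruct in
theorem mainTheorem2 {n : ℕ} (hn : 0 < n) (L : Matrix (Fin n) (Fin n) ℕ)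
    (hL : ∀ i, L i i = 0) :
    -- the subroutine computes `min D_{≥0}(L)`
    (algMinD n L : Set (Fin n → ℕ)) = minDGeZero L ∧
    -- the irreducible case
    (¬ IsReducible L →
      ∃ D : Finset (Fin n → ℕ), algAA L = Output.vectors D ∧
        (D : Set (Fin n → ℕ)) = dStructures L ∧
        dStructures L = {d | d ∈ minDGeZero L ∧ (diagSub L d).det = 0} ∧
        ∀ d ∈ D, ∃! r : Fin n → ℕ, (d, r) ∈ structures L) ∧
    -- a zero row
    (HasZeroRow L →
      algAA L = Output.vectors ∅ ∧ dStructures L = ∅ ∧ structures L = ∅) ∧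
    -- otherwise
    (IsReducible L → ¬ HasZeroRow L →
      algAA L = Output.infinitelyMany ∧ (structures L).Infinite) := by
  have hmin := coe_algMinD hn L hL
  refine ⟨hmin, fun hirr => ?_, fun hrow => ?_, fun hred hrow => ?_⟩
  · have hmem : ∀ d, d ∈ (algMinD n L).filter (fun d => (diagSub L d).det = 0) ↔
        d ∈ minDGeZero L ∧ (diagSub L d).det = 0 := by
      intro d
      rw [Finset.mem_filter, ← Finset.mem_coe, hmin]
    refine ⟨_, if_pos hirr, ?_, dStructures_eq hn hirr, fun d hd => ?_⟩
    · rw [dStructures_eq hn hirr]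
      exact Set.ext hmem
    · obtain ⟨h1, h2⟩ := (hmem d).1 hd
      obtain ⟨r, hr⟩ := exists_mem_structures h1.1 h2
      exact ⟨r, hr, fun r' hr' => mem_structures_unique hn h1.1 hr hr'⟩
  · exact ⟨algAA_eq_of_hasZeroRow hn hL hrow, dStructures_eq_empty hrow, structures_eq_empty hrow⟩
  · refine ⟨?_, infinite_structures hred hrow⟩
    unfold algAA
    rw [if_neg (not_not.2 hred), if_neg hrow]
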